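/- **Setting.** Let $0<\varepsilon\le 1$, $u\ge 1$ and $K\ge 2$. A $K$-armed bandit problem is a tuple $\nu=(\nu_1,\dots,\nu_K)$ of probability distributions on $\mathbb R$ with $\mathbb E_{X\sim\nu_k}|X|^{1+\varepsilon}\le u$ for all $k$; put $\mu_k=\mathbb E_{X\sim\nu_k}[X]$ and $\mu_*=\max_k\mu_k$. There are $M\ge 1$ agents. In each round $t=1,2,\dots$ every agent $m$ chooses an arm $A_{m,t}$ and receives a reward $X_{m,t}$ which, given the past and the chosen arms, has law $\nu_{A_{m,t}}$, independently over agents. $N_k(T)$ is the number of pulls of arm $k$ by all agents in the first $T$ rounds, and the group regret is $R(T)=\mathbb E\big[\sum_{m=1}^M\sum_{t=1}^T(\mu_*-\mu_{A_{m,t}})\big]$. A *decentralized policy* on a connected graph $\mathcal G$ with vertex set $\{1,\dots,M\}$ (graph distance $d$) works as follows. After its pull in round $s$, agent $m'$ sends the message $q_{m'}(s)=F_{m',s}(A_{m',1},X_{m',1},\dots,A_{m',s},X_{m',s})$, where $F_{m',s}:\mathbb R^{2s}\to\mathbb R^{2s}$ is a deterministic, bijective, differentiable map and the absolute value of its Jacobian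 determinant is a constant $\Lambda(m',s)$. Agent $m$ receives this message at the end of round $s+\max(0,d(m',m)-1)$. In round $t$ each agent draws its arm, independently of the others, from a distribution that depends (measurably) on its own action-reward pairs from rounds before $t$ and on the messages received before round $t$. In a *lossless centralized policy* the arms of all agents in round $t$ are drawn from a joint distribution that depends (measurably) on all action-reward pairs of all agents from rounds before $t$. A policy is *consistent* if for every $K$-armed bandit problem as above, every arm $k$ with $\mu_k<\mu_*$ and every $a>0$ one has $\mathbb E[N_k(T)]=o(T^a)$ as $T\to\infty$. **Claim.** (1) For all such $\varepsilon,u,K$ and every $\Delta\in(0,1/4)$ there are a $b>0$, distributions $\nu_1,\dots,\nu_K$, each the law of $b$ times a Bernoulli variable, with $\mathbb E_{X\sim\nu_k}|X|^{1+\varepsilon}\le u$ for all $k$, and an arm $k_*$ with $\mu_{k_*}-\mu_k=\Delta$ for all $k\ne k_*$, such that for every $M\ge1$, every connected graph $\mathcal G$ on $M$ agents and every consistent decentralized policy on $\mathcal G$, the group regret on $\nu_1,\dots,\nu_K$ satisfies, for all sufficiently large $T$, $$R(T)\ \ge\ \Big(\sum_{k\ne k_*}2^{1-1/\varepsilon}\,\Delta^{-1/\varepsilon}\Big)\ln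 T .$$ (2) There is an absolute constant $c>0$ such that for all such $\varepsilon,u,K$ and every $T\ge K$ there are distributions $\nu_1,\dots,\nu_K$ with $\mathbb E_{X\sim\nu_k}|X|^{1+\varepsilon}\le u$ for all $k$ such that, for every $1\le M\le K$ and every consistent lossless centralized policy over $M$ agents, there is an assignment of these $K$ distributions to the $K$ arms (a permutation $\sigma$) such that on the problem $(\nu_{\sigma(1)},\dots,\nu_{\sigma(K)})$ $$R(T)\ \ge\ c\,K^{\frac{\varepsilon}{1+\varepsilon}}\,T^{\frac1{1+\varepsilon}} .$$ -/

import Mathlib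

open MeasureTheory ProbabilityTheory Filter
open scoped ENNReal

noncomputable section

namespace CoopBandit

/-- Histories after `t` rounds: the action-reward pairs of all agents `v : V` in rounds
`0, …, t - 1`, for a bandit with `K` arms. -/
abbrev Hist (V : Type*) (K t : ℕ) : Type _ := Fin t → V → Fin K × ℝ

/-- An arm distribution `ν` satisfies `𝔼_{X ∼ ν} |X| ^ (1 + ε) ≤ u`. -/
def MomentBound (ε u : ℝ) (ν : ProbabilityMeasure ℝ) : Prop :=
  ∫⁻ x, ENNReal.ofReal (|x| ^ (1 + ε)) ∂(ν : Measure ℝ) ≤ ENNReal.ofReal u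

/-- The mean of an arm distribution. -/
def armMean (ν : ProbabilityMeasure ℝ) : ℝ := ∫ x, x ∂(ν : Measure ℝ)

/-- The largest arm mean `μ_*` of a bandit problem. -/
def bestMean {K : ℕ} (ν : Fin K → ProbabilityMeasure ℝ) : ℝ := ⨆ k, armMean (ν k)

/-- `ν` is the law of `b` times a Bernoulli variable. -/
def IsScaledBernoulli (b : ℝ) (ν : ProbabilityMeasure ℝ) : Prop :=
  ∃ p : ℝ, 0 ≤ p ∧ p ≤ 1 ∧
    (ν : Measure ℝ) =
      ENNReal.ofReal (1 - p) • Measure.dirac 0 + ENNReal.ofReal p • Measure.dirac b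

/-- A lossless centralized policy: in round `t` the actions of all agents are drawn jointly, from a
distribution that may depend on all earlier action-reward pairs of all agents. -/
structure CentralizedPolicy (V : Type*) (K : ℕ) where
  act : ∀ t : ℕ, Kernel (Hist V K t) (V → Fin K)
  markov : ∀ t, IsMarkovKernel (act t)

attribute [instance] CentralizedPolicy.markov

/-- Given the actions `a` of the agents in a round, the action-reward pairs of that round: agent `v`
obtains an independent reward with law `ν (a v)`. -/
def rewardKernel (V : Type*) [Fintype V] {K : ℕ} (ν : Fin K → ProbabilityMeasure ℝ) :
    Kernel (V → Fin K) (V → Fin K × ℝ) :=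
  Kernel.ofFunOfCountable fun a =>
    Measure.pi fun v => (Measure.dirac (a v)).prod (ν (a v) : Measure ℝ)

instance {V : Type*} [Fintype V] {K : ℕ} (ν : Fin K → ProbabilityMeasure ℝ) :
    IsMarkovKernel (rewardKernel V ν) :=
  ⟨fun a => by
    change IsProbabilityMeasure (Measure.pi _)
    infer_instance⟩

/-- Appending one round to a history. -/
def extend {V : Type*} {K t : ℕ} (p : Hist V K t × (V → Fin K × ℝ)) : Hist V K (t + 1) :=
  Fin.snoc (α := fun _ => V → Fin K × ℝ) p.1 p.2

lemma measurable_extend {V : Type*} {K t : ℕ} :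
    Measurable (extend : Hist V K t × (V → Fin K × ℝ) → Hist V K (t + 1)) := by
  refine measurable_pi_lambda _ fun i => ?_
  refine Fin.lastCases ?_ (fun j => ?_) i
  · simpa [extend] using measurable_snd
  · have h1 : Measurable fun p : Hist V K t × (V → Fin K × ℝ) => p.1 j :=
      (measurable_pi_apply j).comp measurable_fst
    simpa [extend] using h1

/-- The canonical bandit measure: the law of the history of `T` rounds of the interaction of a
policy with the bandit problem `ν`. -/
def CentralizedPolicy.law {V : Type*} [Fintype V] {K : ℕ} (P : CentralizedPolicy V K)
    (ν : Fin K → ProbabilityMeasure ℝ) : ∀ T : ℕ, Measure (Hist V K T)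
  | 0 => Measure.dirac Fin.elim0
  | T + 1 => ((P.law ν T) ⊗ₘ (rewardKernel V ν ∘ₖ P.act T)).map extend

instance CentralizedPolicy.law_isProbabilityMeasure {V : Type*} [Fintype V] {K : ℕ}
    (P : CentralizedPolicy V K) (ν : Fin K → ProbabilityMeasure ℝ) (T : ℕ) :
    IsProbabilityMeasure (P.law ν T) := by
  induction T with
  | zero => rw [CentralizedPolicy.law]; infer_instance
  | succ T ih =>
    rw [CentralizedPolicy.law]
    exact Measure.isProbabilityMeasure_map measurable_extend.aemeasurable

/-- The number of pulls of arm `k` by all agents in `T` rounds. -/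
def pulls {V : Type*} [Fintype V] {K T : ℕ} (k : Fin K) (h : Hist V K T) : ℕ :=
  ∑ t : Fin T, ∑ v : V, if (h t v).1 = k then 1 else 0

/-- `𝔼[N_k(T)]`. -/
def CentralizedPolicy.expectedPulls {V : Type*} [Fintype V] {K : ℕ} (P : CentralizedPolicy V K)
    (ν : Fin K → ProbabilityMeasure ℝ) (k : Fin K) (T : ℕ) : ℝ :=
  ∫ h, (pulls k h : ℝ) ∂(P.law ν T)

/-- The (expected) group regret after `T` rounds, `𝔼[∑_v ∑_t (μ_* - μ_{A_{v,t}})]`. -/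
def CentralizedPolicy.groupRegret {V : Type*} [Fintype V] {K : ℕ} (P : CentralizedPolicy V K)
    (ν : Fin K → ProbabilityMeasure ℝ) (T : ℕ) : ℝ :=
  ∫ h, (∑ v : V, ∑ t : Fin T, (bestMean ν - armMean (ν (h t v).1))) ∂(P.law ν T)

/-- Consistency over the class of all `K`-armed bandit problems whose arms have `(1 + ε)`-moments
bounded by `u`: every suboptimal arm is pulled `o(T ^ a)` times in expectation, for all `a > 0`. -/
def CentralizedPolicy.IsConsistent {V : Type*} [Fintype V] {K : ℕ} (P : CentralizedPolicy V K)
    (ε u : ℝ) : Prop :=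
  ∀ ν : Fin K → ProbabilityMeasure ℝ, (∀ k, MomentBound ε u (ν k)) →
    ∀ k, armMean (ν k) < bestMean ν → ∀ a : ℝ, 0 < a →
      (fun T : ℕ => P.expectedPulls ν k T) =o[atTop] (fun T : ℕ => (T : ℝ) ^ a)

/-- The message functions `F_{v,n} : ℝ^{2n} → ℝ^{2n}` that the agents use, applied to their first `n`
action-reward pairs: deterministic, bijective, differentiable maps whose Jacobian determinant has
an absolute value `Λ v n` that depends on `v` and `n` only. -/
structure Protocol (V : Type*) where
  F : V → ∀ n : ℕ, (Fin n → ℝ × ℝ) → (Fin n → ℝ × ℝ)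
  bijective : ∀ v n, Function.Bijective (F v n)
  differentiable : ∀ v n, Differentiable ℝ (F v n)
  Λ : V → ℕ → ℝ
  jacobian : ∀ v n x, |(fderiv ℝ (F v n) x).det| = Λ v n

/-- The action-reward pairs of agent `v` in rounds `0, …, s`, as a point of `ℝ^{2(s+1)}`. -/
def ownPairs {V : Type*} {K t : ℕ} (h : Hist V K t) (v : V) (s : Fin t) :
    Fin (s + 1) → ℝ × ℝ :=
  fun i => (((h ⟨i, by omega⟩ v).1 : ℕ), (h ⟨i, by omega⟩ v).2)

/-- The messages that agent `v` can use when it chooses its action in round `t`. The message that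
agent `w` creates after its pull in round `s` is received by `v` at the end of round
`s + max (0, d(w, v) - 1)` (the natural number `d(w, v) - 1` is that maximum). -/
abbrev Inbox {V : Type*} (G : SimpleGraph V) (v : V) (t : ℕ) : Type _ :=
  ∀ w : V, ∀ s : {s : Fin t // (s : ℕ) + (G.dist w v - 1) < t}, Fin (s.1 + 1) → ℝ × ℝ

/-- What agent `v` knows when it chooses its action in round `t`: its own earlier action-reward
pairs, and the messages received so far. -/
abbrev Info {V : Type*} (G : SimpleGraph V) (K : ℕ) (v : V) (t : ℕ) : Type _ :=
  (Fin t → Fin K × ℝ) × Inbox G v t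

/-- The information of agent `v` in round `t` after the history `h`. -/
def info {V : Type*} (G : SimpleGraph V) {K : ℕ} (C : Protocol V) (v : V) (t : ℕ)
    (h : Hist V K t) : Info G K v t :=
  (fun s => h s v, fun w s => C.F w (s.1 + 1) (ownPairs h w s.1))

lemma measurable_info {V : Type*} (G : SimpleGraph V) {K : ℕ} (C : Protocol V) (v : V) (t : ℕ) :
    Measurable (info (K := K) G C v t) := by
  refine Measurable.prodMk ?_ ?_
  · exact measurable_pi_lambda _ fun s => (measurable_pi_apply v).comp (measurable_pi_apply s)
  · refine measurable_pi_lambda _ fun w => measurable_pi_lambda _ fun s => ?_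
    refine (C.differentiable w _).continuous.measurable.comp ?_
    refine measurable_pi_lambda _ fun i => ?_
    have h1 : Measurable fun h : Hist V K t => h ⟨(i : ℕ), by omega⟩ w :=
      (measurable_pi_apply w).comp (measurable_pi_apply _)
    exact Measurable.prodMk
      ((Measurable.of_discrete (f := fun k : Fin K => ((k : ℕ) : ℝ))).comp (measurable_fst.comp h1))
      (measurable_snd.comp h1)

lemma measurable_measure_pi {V α : Type*} [Fintype V] [MeasurableSpace α] {K : ℕ}
    (κ : V → Kernel α (Fin K)) [∀ v, IsMarkovKernel (κ v)] :
    Measurable fun x => Measure.pi fun v => κ v x := by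
  refine Measurable.measure_of_isPiSystem_of_isProbabilityMeasure
    generateFrom_pi.symm isPiSystem_pi ?_
  rintro _ ⟨s, hs, rfl⟩
  simp only [Measure.pi_pi]
  exact Finset.measurable_prod _ fun v _ => Kernel.measurable_coe _ (hs v (Set.mem_univ v))

/-- A decentralized policy of agents that communicate over `G`: each agent draws its action,
independently of the others, from a distribution determined by its own information. -/
structure DecentralizedPolicy {V : Type*} (G : SimpleGraph V) (K : ℕ) where
  protocol : Protocol V
  act : ∀ (v : V) (t : ℕ), Kernel (Info G K v t) (Fin K)
  markov : ∀ v t, IsMarkovKernel (act v t)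

attribute [instance] DecentralizedPolicy.markov

/-- The collective policy of the agents: given the history, the actions in a round are independent,
and agent `v` acts according to its policy applied to its information. -/
def DecentralizedPolicy.toCentralized {V : Type*} [Fintype V] {G : SimpleGraph V} {K : ℕ}
    (P : DecentralizedPolicy G K) : CentralizedPolicy V K where
  act t :=
    { toFun := fun h => Measure.pi fun v => P.act v t (info G P.protocol v t h)
      measurable' := measurable_measure_pi fun v =>
        (P.act v t).comap (info G P.protocol v t) (measurable_info G P.protocol v t) }
  markov t := ⟨fun h => by
    change IsProbabilityMeasure (Measure.pi _)
    infer_instance⟩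

end CoopBandit

end

noncomputable section

namespace CoopBandit

/-! A group that rarely pulls an arm cannot notice that this arm has become the best one. The
policy's own choices cancel in the likelihood ratio of two problems, so for problems that differ
only in arm `j` its logarithm is a sum over the pulls of `j` (`law_withDensity`), and by Wald's
identity (`integral_score`) its mean is `-KL * 𝔼[N_j(T)]`.

Two inequalities, applied to the fraction `W` of pulls that go to `j`, turn this into regret. For
(1), consistency makes `W` small before the change and `1 - W` small after it, and
`exp_integral_sub_one_le` then forces `KL * 𝔼[N_j(T)]` to be almost `log T`. For (2), one of `K`
equal arms gets at most a share `1/K` of the pulls, and `integral_le_integral_add` shows that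
improving it changes this share too little.

The arms are `b` times Bernoulli variables with parameters at most `Q`, where `Q * b ^ (1 + ε) = 1`.
Gaps are then of order `Q * b = Q ^ (ε / (1 + ε))`, while the relative entropies are only of order
`Q`; this yields the heavy-tailed rates. Both bounds hold for agents that share everything, and
`toCentralized` carries (1) over to decentralized policies. -/

/-- The sum of `φ` over all action-reward pairs of a history. -/
def score {V : Type*} [Fintype V] {K T : ℕ} (φ : Fin K × ℝ → ℝ) (h : Hist V K T) : ℝ :=
  ∑ t : Fin T, ∑ v : V, φ (h t v)

/-! ### Pull counts and the decomposition of the regret -/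

section Score

lemma integrable_comp_round {V : Type*} {K : ℕ} {φ : Fin K × ℝ → ℝ} (hφ : Measurable φ) {C : ℝ}
    (hC : ∀ z, |φ z| ≤ C) (v : V) (μ : Measure (V → Fin K × ℝ)) [IsFiniteMeasure μ] :
    Integrable (fun r => φ (r v)) μ :=
  Integrable.of_bound (hφ.comp (measurable_pi_apply v)).aestronglyMeasurable C
    (ae_of_all _ fun r => hC (r v))

variable {V : Type*} [Fintype V] {K T : ℕ}

lemma score_extend (φ : Fin K × ℝ → ℝ) (p : Hist V K T × (V → Fin K × ℝ)) :
    score φ (extend p) = score φ p.1 + ∑ v, φ (p.2 v) := by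
  simp [score, extend, Fin.sum_univ_castSucc]

lemma measurable_score {φ : Fin K × ℝ → ℝ} (hφ : Measurable φ) :
    Measurable (score φ : Hist V K T → ℝ) := by
  refine Finset.measurable_sum _ fun t _ => Finset.measurable_sum _ fun v _ => ?_
  exact hφ.comp ((measurable_pi_apply v).comp (measurable_pi_apply t))

lemma abs_score_le {φ : Fin K × ℝ → ℝ} {C : ℝ} (hC : ∀ z, |φ z| ≤ C) (h : Hist V K T) :
    |score φ h| ≤ T * (Fintype.card V * C) := by
  refine (Finset.abs_sum_le_sum_abs _ _).trans ?_
  have : ∀ t ∈ (Finset.univ : Finset (Fin T)), |∑ v, φ (h t v)| ≤ Fintype.card V * C := by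
    intro t _
    refine (Finset.abs_sum_le_sum_abs _ _).trans ?_
    refine (Finset.sum_le_sum fun v _ => hC (h t v)).trans ?_
    simp
  refine (Finset.sum_le_sum this).trans ?_
  simp

lemma integrable_score {φ : Fin K × ℝ → ℝ} (hφ : Measurable φ) {C : ℝ} (hC : ∀ z, |φ z| ≤ C)
    (μ : Measure (Hist V K T)) [IsFiniteMeasure μ] : Integrable (score φ) μ :=
  Integrable.of_bound (measurable_score hφ).aestronglyMeasurable _
    (ae_of_all _ fun h => abs_score_le hC h)

lemma score_sub (φ ψ : Fin K × ℝ → ℝ) (h : Hist V K T) :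
    score (fun z => φ z - ψ z) h = score φ h - score ψ h := by
  simp [score, Finset.sum_sub_distrib]

lemma pulls_eq_score (k : Fin K) (h : Hist V K T) :
    (pulls k h : ℝ) = score (fun z => if z.1 = k then 1 else 0) h := by
  simp [pulls, score]

lemma score_fst (m : Fin K → ℝ) (h : Hist V K T) :
    score (fun z => m z.1) h = ∑ k, m k * pulls k h := by
  simp only [pulls_eq_score, score, Finset.mul_sum]
  rw [Finset.sum_comm (s := (Finset.univ : Finset (Fin K)))]
  refine Finset.sum_congr rfl fun t _ => ?_
  rw [Finset.sum_comm (s := (Finset.univ : Finset (Fin K)))]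
  refine Finset.sum_congr rfl fun v _ => ?_
  simp

lemma sum_pulls (h : Hist V K T) : ∑ k, (pulls k h : ℝ) = T * Fintype.card V := by
  have := score_fst (fun _ => 1) h
  simp only [one_mul] at this
  rw [← this]
  simp [score]

lemma pulls_le (k : Fin K) (h : Hist V K T) : (pulls k h : ℝ) ≤ T * Fintype.card V := by
  rw [← sum_pulls h]
  exact Finset.single_le_sum (f := fun k => (pulls k h : ℝ)) (fun i _ => by positivity)
    (Finset.mem_univ k)

lemma measurable_pulls (k : Fin K) : Measurable fun h : Hist V K T => (pulls k h : ℝ) := by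
  simp only [pulls_eq_score]
  refine measurable_score ?_
  exact (Measurable.of_discrete (f := fun a : Fin K => if a = k then (1 : ℝ) else 0)).comp
    measurable_fst

lemma integrable_pulls (k : Fin K) (μ : Measure (Hist V K T)) [IsFiniteMeasure μ] :
    Integrable (fun h => (pulls k h : ℝ)) μ :=
  Integrable.of_bound (measurable_pulls k).aestronglyMeasurable (T * Fintype.card V)
    (ae_of_all _ fun h => by
      rw [Real.norm_of_nonneg (by positivity)]; exact pulls_le k h)

variable (P : CentralizedPolicy V K) (ν : Fin K → ProbabilityMeasure ℝ)

lemma expectedPulls_nonneg (k : Fin K) (T : ℕ) : 0 ≤ P.expectedPulls ν k T :=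
  integral_nonneg fun h => by positivity

lemma sum_expectedPulls (T : ℕ) : ∑ k, P.expectedPulls ν k T = T * Fintype.card V := by
  simp only [CentralizedPolicy.expectedPulls]
  rw [← integral_finsetSum _ fun k _ => integrable_pulls k _]
  simp [sum_pulls]

lemma integral_score_fst (m : Fin K → ℝ) (T : ℕ) :
    ∫ h, score (fun z => m z.1) h ∂(P.law ν T) = ∑ k, m k * P.expectedPulls ν k T := by
  simp only [score_fst]
  rw [integral_finsetSum _ fun k _ => (integrable_pulls k _).const_mul _]
  simp [CentralizedPolicy.expectedPulls, integral_const_mul]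

lemma groupRegret_eq (T : ℕ) :
    P.groupRegret ν T = ∑ k, (bestMean ν - armMean (ν k)) * P.expectedPulls ν k T := by
  rw [← integral_score_fst P ν (fun k => bestMean ν - armMean (ν k)), CentralizedPolicy.groupRegret]
  refine integral_congr_ae (ae_of_all _ fun h => ?_)
  simp only [score]
  exact Finset.sum_comm

/-! ### Recursion over rounds and Wald's identity -/

/-- The actions and rewards of a round, given the history. -/
def roundKernel (T : ℕ) : Kernel (Hist V K T) (V → Fin K × ℝ) := rewardKernel V ν ∘ₖ P.act T

instance (T : ℕ) : IsMarkovKernel (roundKernel P ν T) := by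
  unfold roundKernel; infer_instance

lemma law_succ (T : ℕ) :
    P.law ν (T + 1) = ((P.law ν T) ⊗ₘ roundKernel P ν T).map extend := rfl

/-- The appended round comes from a Markov kernel, so forgetting it restores the shorter law. This
allows horizons to be compared. -/
lemma integral_law_succ_comp_init (T : ℕ) (f : Hist V K T → ℝ) (hf : Measurable f) :
    ∫ h, f (Fin.init (α := fun _ => V → Fin K × ℝ) h) ∂(P.law ν (T + 1))
      = ∫ h, f h ∂(P.law ν T) := by
  have hm : Measurable (Fin.init (α := fun _ => V → Fin K × ℝ) : Hist V K (T + 1) → Hist V K T) :=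
    measurable_pi_lambda _ fun i => measurable_pi_apply _
  have hfm : Measurable fun h : Hist V K (T + 1) =>
      f (Fin.init (α := fun _ => V → Fin K × ℝ) h) := hf.comp hm
  rw [law_succ, integral_map measurable_extend.aemeasurable hfm.aestronglyMeasurable]
  simp only [extend, Fin.init_snoc]
  conv_rhs => rw [← Measure.fst_compProd (P.law ν T) (roundKernel P ν T), Measure.fst,
    integral_map measurable_fst.aemeasurable hf.aestronglyMeasurable]

lemma expectedPulls_mono (k : Fin K) : Monotone (P.expectedPulls ν k) := by
  refine monotone_nat_of_le_succ fun T => ?_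
  rw [CentralizedPolicy.expectedPulls,
    ← integral_law_succ_comp_init P ν T _ (measurable_pulls k)]
  refine integral_mono_of_nonneg (ae_of_all _ fun h => by positivity) (integrable_pulls k _)
    (ae_of_all _ fun h => ?_)
  simp only [Nat.cast_le, pulls]
  rw [Fin.sum_univ_castSucc]
  exact Nat.le_add_right _ _

lemma rewardKernel_apply (a : V → Fin K) :
    rewardKernel V ν a = Measure.pi fun v => (Measure.dirac (a v)).prod (ν (a v) : Measure ℝ) := rfl

lemma integral_rewardKernel {φ : Fin K × ℝ → ℝ} (hφ : Measurable φ) (a : V → Fin K) (v : V) :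
    ∫ r, φ (r v) ∂(rewardKernel V ν a) = ∫ x, φ (a v, x) ∂(ν (a v) : Measure ℝ) := by
  rw [rewardKernel_apply]
  rw [integral_comp_eval (μ := fun v => (Measure.dirac (a v)).prod (ν (a v) : Measure ℝ))
    (f := φ) hφ.aestronglyMeasurable]
  rw [Measure.dirac_prod, integral_map (by fun_prop) hφ.aestronglyMeasurable]

/-- Each round adds terms of conditional mean zero given the past, so the score is a martingale
started at zero. -/
lemma integral_score_eq_zero {φ : Fin K × ℝ → ℝ} (hφ : Measurable φ) {C : ℝ}
    (hC : ∀ z, |φ z| ≤ C) (h0 : ∀ k, ∫ x, φ (k, x) ∂(ν k : Measure ℝ) = 0) (T : ℕ) :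
    ∫ h, score φ h ∂(P.law ν T) = 0 := by
  induction T with
  | zero => simp [score]
  | succ T ih =>
    have hr (h : Hist V K T) : ∫ r, ∑ v, φ (r v) ∂(roundKernel P ν T h) = 0 := by
      rw [integral_finsetSum _ fun v _ => integrable_comp_round hφ hC v _]
      refine Finset.sum_eq_zero fun v _ => ?_
      rw [roundKernel, Kernel.integral_comp (integrable_comp_round hφ hC v _)]
      simp [integral_rewardKernel ν hφ, h0]
    have hi : Integrable (fun p : Hist V K T × (V → Fin K × ℝ) => score φ (extend p))
        (P.law ν T ⊗ₘ roundKernel P ν T) := by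
      refine Integrable.of_bound ((measurable_score hφ).comp measurable_extend).aestronglyMeasurable
        _ (ae_of_all _ fun p => abs_score_le hC _)
    rw [law_succ, integral_map measurable_extend.aemeasurable
      (measurable_score hφ).aestronglyMeasurable, Measure.integral_compProd hi]
    rw [← ih]
    refine integral_congr_ae (ae_of_all _ fun h => ?_)
    simp only [score_extend]
    rw [integral_add (integrable_const _)
      (integrable_finsetSum _ fun v _ => integrable_comp_round hφ hC v _), hr]
    simp

/-- Wald's identity for the histories of a bandit. -/
lemma integral_score {φ : Fin K × ℝ → ℝ} (hφ : Measurable φ) {C : ℝ}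
    (hC : ∀ z, |φ z| ≤ C) (T : ℕ) :
    ∫ h, score φ h ∂(P.law ν T)
      = ∑ k, (∫ x, φ (k, x) ∂(ν k : Measure ℝ)) * P.expectedPulls ν k T := by
  set m : Fin K → ℝ := fun k => ∫ x, φ (k, x) ∂(ν k : Measure ℝ) with hm
  have hmb (k : Fin K) : |m k| ≤ C := by
    have := norm_integral_le_of_norm_le_const (μ := (ν k : Measure ℝ))
      (f := fun x => φ (k, x)) (ae_of_all _ fun x => hC (k, x))
    simpa using this
  have hmm : Measurable fun z : Fin K × ℝ => m z.1 :=
    (Measurable.of_discrete (f := m)).comp measurable_fst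
  -- Centring `φ` by its mean on each arm reduces to the martingale case; the part removed depends
  -- on the arm only, so it is a combination of pull counts.
  have h0 := integral_score_eq_zero P ν (hφ.sub hmm) (C := C + C)
    (fun z => (abs_sub _ _).trans (add_le_add (hC z) (hmb z.1))) (fun k => ?_) T
  · simp only [Pi.sub_def, score_sub] at h0
    rw [integral_sub (integrable_score hφ hC _) (integrable_score hmm (fun z => hmb z.1) _),
      integral_score_fst] at h0
    linarith
  · simp only [Pi.sub_apply]
    have hk : Measurable fun x => φ (k, x) := hφ.comp measurable_prodMk_left
    rw [integral_sub (Integrable.of_bound hk.aestronglyMeasurable C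
      (ae_of_all _ fun x => hC (k, x))) (integrable_const _)]
    simp [hm]

/-! ### Likelihood ratios of histories -/

lemma pi_withDensity {α : V → Type*} [∀ v, MeasurableSpace (α v)] (μ : ∀ v, Measure (α v))
    [∀ v, IsProbabilityMeasure (μ v)] {ρ : ∀ v, α v → ℝ≥0∞} (hρ : ∀ v, Measurable (ρ v))
    [∀ v, IsProbabilityMeasure ((μ v).withDensity (ρ v))] :
    Measure.pi (fun v => (μ v).withDensity (ρ v))
      = (Measure.pi μ).withDensity fun x => ∏ v, ρ v (x v) := by
  refine Measure.pi_eq fun s hs => ?_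
  rw [withDensity_apply _ (MeasurableSet.univ_pi hs), ← lintegral_indicator (.univ_pi hs)]
  have h1 (x : ∀ v, α v) : (Set.univ.pi s).indicator (fun x => ∏ v, ρ v (x v)) x
      = ∏ v, (s v).indicator (ρ v) (x v) := by
    by_cases hx : x ∈ Set.univ.pi s
    · rw [Set.indicator_of_mem hx]
      exact Finset.prod_congr rfl fun v _ => (Set.indicator_of_mem (hx v trivial) _).symm
    · rw [Set.indicator_of_notMem hx]
      simp only [Set.mem_pi, Set.mem_univ, true_implies, not_forall] at hx
      obtain ⟨v, hv⟩ := hx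
      exact (Finset.prod_eq_zero (Finset.mem_univ v) (Set.indicator_of_notMem hv _)).symm
  simp only [h1]
  have hm (v : V) : Measurable ((s v).indicator (ρ v)) := (hρ v).indicator (hs v)
  have hind : iIndepFun (fun v (x : ∀ v, α v) => (s v).indicator (ρ v) (x v)) (Measure.pi μ) :=
    iIndepFun_pi fun v => (hm v).aemeasurable
  rw [lintegral_prod_eq_prod_lintegral_of_indepFun Finset.univ _ hind
    fun v => (hm v).comp (measurable_pi_apply v)]
  refine Finset.prod_congr rfl fun v _ => ?_
  rw [withDensity_apply _ (hs v), ← lintegral_indicator (hs v)]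
  exact ((measurePreserving_eval μ v).lintegral_comp (hm v))

variable {ν} {ν' : Fin K → ProbabilityMeasure ℝ}

lemma rewardKernel_withDensity {φ : Fin K × ℝ → ℝ} (hφ : Measurable φ)
    (hν : ∀ k, (ν' k : Measure ℝ)
      = (ν k : Measure ℝ).withDensity fun x => ENNReal.ofReal (Real.exp (φ (k, x))))
    (a : V → Fin K) :
    rewardKernel V ν' a = (rewardKernel V ν a).withDensity
      fun r => ENNReal.ofReal (Real.exp (∑ v, φ (r v))) := by
  have hd : Measurable fun z => ENNReal.ofReal (Real.exp (φ z)) := by fun_prop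
  have h1 (k : Fin K) : (Measure.dirac k).prod (ν' k : Measure ℝ)
      = ((Measure.dirac k).prod (ν k : Measure ℝ)).withDensity
        fun z => ENNReal.ofReal (Real.exp (φ z)) := by
    ext s hs
    rw [withDensity_apply _ hs, ← lintegral_indicator hs, Measure.dirac_prod, Measure.dirac_prod,
      lintegral_map (hd.indicator hs) (by fun_prop), Measure.map_apply (by fun_prop) hs, hν,
      withDensity_apply _ (measurable_prodMk_left hs),
      ← lintegral_indicator (measurable_prodMk_left hs)]
    rfl
  have h2 (v : V) : IsProbabilityMeasure
      (((Measure.dirac (a v)).prod (ν (a v) : Measure ℝ)).withDensity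
        fun z => ENNReal.ofReal (Real.exp (φ z))) := by
    rw [← h1]; infer_instance
  rw [rewardKernel_apply, rewardKernel_apply]
  simp only [h1]
  rw [pi_withDensity _ fun v => hd]
  congr 1
  ext r
  rw [Real.exp_sum, ENNReal.ofReal_prod_of_nonneg fun v _ => (Real.exp_pos _).le]

/-- The action kernels are the same under both problems and cancel, so each round multiplies the
density by the reward ratios alone. -/
lemma law_withDensity {φ : Fin K × ℝ → ℝ} (hφ : Measurable φ)
    (hν : ∀ k, (ν' k : Measure ℝ)
      = (ν k : Measure ℝ).withDensity fun x => ENNReal.ofReal (Real.exp (φ (k, x)))) (T : ℕ) :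
    P.law ν' T = (P.law ν T).withDensity fun h => ENNReal.ofReal (Real.exp (score φ h)) := by
  induction T with
  | zero =>
    rw [CentralizedPolicy.law, CentralizedPolicy.law]
    simp [score]
  | succ T ih =>
    have hL (T : ℕ) : Measurable fun h : Hist V K T => ENNReal.ofReal (Real.exp (score φ h)) :=
      (measurable_score hφ).exp.ennreal_ofReal
    have hR : Measurable fun r : V → Fin K × ℝ => ENNReal.ofReal (Real.exp (∑ v, φ (r v))) := by
      refine (Measurable.exp ?_).ennreal_ofReal
      exact Finset.measurable_sum _ fun v _ => hφ.comp (measurable_pi_apply v)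
    refine Measure.ext_of_lintegral _ fun f hf => ?_
    have hfe : Measurable fun p : Hist V K T × (V → Fin K × ℝ) => f (extend p) :=
      hf.comp measurable_extend
    have hfL : Measurable fun h : Hist V K (T + 1) =>
      ENNReal.ofReal (Real.exp (score φ h)) * f h := (hL _).mul hf
    have hfLe : Measurable fun p : Hist V K T × (V → Fin K × ℝ) =>
      ENNReal.ofReal (Real.exp (score φ (extend p))) * f (extend p) := hfL.comp measurable_extend
    rw [lintegral_withDensity_eq_lintegral_mul _ (hL _) hf]
    simp only [Pi.mul_apply]
    rw [law_succ, law_succ, lintegral_map hf measurable_extend, lintegral_map hfL measurable_extend,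
      Measure.lintegral_compProd hfe, Measure.lintegral_compProd hfLe, ih,
      lintegral_withDensity_eq_lintegral_mul _ (hL _) hfe.lintegral_kernel_prod_right]
    refine lintegral_congr fun h => ?_
    have hfh : Measurable fun r => f (extend (h, r)) := hfe.comp measurable_prodMk_left
    simp only [Pi.mul_apply, roundKernel, score_extend, Real.exp_add,
      ENNReal.ofReal_mul (Real.exp_pos _).le, mul_assoc]
    have hRf : Measurable fun r : V → Fin K × ℝ =>
      ENNReal.ofReal (Real.exp (∑ v, φ (r v))) * f (extend (h, r)) := hR.mul hfh
    rw [lintegral_const_mul _ hRf, Kernel.lintegral_comp _ _ _ hfh, Kernel.lintegral_comp _ _ _ hRf]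
    congr 1
    refine lintegral_congr fun a => ?_
    rw [rewardKernel_withDensity hφ hν, lintegral_withDensity_eq_lintegral_mul _ hR hfh]
    rfl

end Score

/-! ### Change-of-measure inequalities -/

section ChangeOfMeasure

variable {Ω : Type*} [MeasurableSpace Ω] {μ μ' : Measure Ω} {S W : Ω → ℝ}

lemma integral_withDensity_exp (hS : Measurable S)
    (hμ : μ' = μ.withDensity fun x => ENNReal.ofReal (Real.exp (S x))) (g : Ω → ℝ) :
    ∫ x, g x ∂μ' = ∫ x, Real.exp (S x) * g x ∂μ := by
  rw [hμ, integral_withDensity_eq_integral_toReal_smul hS.exp.ennreal_ofReal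
    (ae_of_all _ fun x => ENNReal.ofReal_lt_top)]
  simp [ENNReal.toReal_ofReal (Real.exp_pos _).le]

variable [IsProbabilityMeasure μ] [IsProbabilityMeasure μ']

lemma integrable_exp_of_abs_le (hS : Measurable S) {C : ℝ} (hC : ∀ x, |S x| ≤ C) :
    Integrable (fun x => Real.exp (S x)) μ :=
  Integrable.of_bound hS.exp.aestronglyMeasurable (Real.exp C) (ae_of_all _ fun x => by
    rw [Real.norm_of_nonneg (Real.exp_pos _).le]
    exact Real.exp_le_exp.2 ((le_abs_self _).trans (hC x)))

lemma integrable_exp_mul_of_abs_le (hS : Measurable S) {C : ℝ} (hC : ∀ x, |S x| ≤ C)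
    (hW : Measurable W) (hW0 : ∀ x, 0 ≤ W x) (hW1 : ∀ x, W x ≤ 1) :
    Integrable (fun x => Real.exp (S x) * W x) μ :=
  (integrable_exp_of_abs_le hS hC).mul_bdd (c := 1) hW.aestronglyMeasurable
    (ae_of_all _ fun x => by rw [Real.norm_of_nonneg (hW0 x)]; exact hW1 x)

/-- A form of the Bretagnolle–Huber inequality. -/
lemma exp_integral_sub_one_le (hS : Measurable S) {C : ℝ} (hC : ∀ x, |S x| ≤ C)
    (hμ : μ' = μ.withDensity fun x => ENNReal.ofReal (Real.exp (S x)))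
    (hW : Measurable W) (hW0 : ∀ x, 0 ≤ W x) (hW1 : ∀ x, W x ≤ 1) :
    Real.exp (∫ x, S x ∂μ - 1) ≤ ∫ x, W x ∂μ + ∫ x, (1 - W x) ∂μ' := by
  have hSi : Integrable S μ := Integrable.of_bound hS.aestronglyMeasurable C (ae_of_all _ hC)
  have hE := integrable_exp_of_abs_le (μ := μ) hS hC
  have hWi : Integrable W μ := Integrable.of_bound hW.aestronglyMeasurable 1
    (ae_of_all _ fun x => by rw [Real.norm_of_nonneg (hW0 x)]; exact hW1 x)
  have hEW := integrable_exp_mul_of_abs_le (μ := μ) (W := fun x => 1 - W x) hS hC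
    (measurable_const.sub hW) (fun x => sub_nonneg.2 (hW1 x)) (fun x => sub_le_self 1 (hW0 x))
  have h1 : ∫ x, Real.exp (S x) ∂μ = 1 := by
    simpa using (integral_withDensity_exp hS hμ fun _ => 1).symm
  rw [integral_withDensity_exp hS hμ]
  rw [← integral_add hWi hEW]
  -- The tangent to `exp` at this point gives a lower bound whose integral is exactly `exp c`.
  set c := ∫ x, S x ∂μ - 1 with hc
  have hSc : Integrable (fun x => 1 + S x) μ := (integrable_const _).add hSi
  have hSE : Integrable (fun x => 1 + S x - Real.exp (S x)) μ := hSc.sub hE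
  have hint : ∫ x, Real.exp c * (1 + S x - Real.exp (S x) - c) ∂μ = Real.exp c := by
    rw [integral_const_mul, integral_sub hSE (integrable_const _), integral_sub hSc hE,
      integral_add (integrable_const _) hSi, h1]
    simp only [integral_const, probReal_univ, smul_eq_mul, one_mul]
    rw [show (1 : ℝ) + ∫ x, S x ∂μ - 1 - c = 1 by rw [hc]; ring, mul_one]
  rw [← hint]
  refine integral_mono ((hSE.sub (integrable_const _)).const_mul _) (hWi.add hEW) fun x => ?_
  have hx := hW0 x
  have hx1 := hW1 x
  have hexp := Real.exp_pos (S x)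
  have key : Real.exp c * (1 + min 0 (S x) - c) ≤ Real.exp (min 0 (S x)) := by
    have := Real.add_one_le_exp (min 0 (S x) - c)
    calc _ ≤ Real.exp c * Real.exp (min 0 (S x) - c) := by
          refine mul_le_mul_of_nonneg_left (by linarith) (Real.exp_pos _).le
      _ = _ := by rw [← Real.exp_add]; ring_nf
  have h2 : S x - Real.exp (S x) ≤ min 0 (S x) := by
    refine le_min ?_ (by linarith)
    linarith [Real.add_one_le_exp (S x)]
  -- The right side is a convex combination of `1` and `exp (S x)`, hence at least their minimum.
  have h3 : Real.exp (min 0 (S x)) ≤ W x + Real.exp (S x) * (1 - W x) := by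
    rcases le_total 0 (S x) with h | h
    · rw [min_eq_left h, Real.exp_zero]
      nlinarith [Real.one_le_exp h]
    · rw [min_eq_right h]
      nlinarith [Real.exp_le_one_iff.2 h]
  refine le_trans ?_ (key.trans h3)
  exact mul_le_mul_of_nonneg_left (by linarith) (Real.exp_pos _).le

/-- A form of Pinsker's inequality. -/
lemma integral_le_integral_add (hS : Measurable S) {C : ℝ} (hC : ∀ x, |S x| ≤ C)
    (hμ : μ' = μ.withDensity fun x => ENNReal.ofReal (Real.exp (S x)))
    (hW : Measurable W) (hW0 : ∀ x, 0 ≤ W x) (hW1 : ∀ x, W x ≤ 1) {s : ℝ} (hs : 0 < s) :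
    ∫ x, W x ∂μ' ≤ ∫ x, W x ∂μ + s - (∫ x, S x ∂μ) / (4 * s) := by
  have hSi : Integrable S μ := Integrable.of_bound hS.aestronglyMeasurable C (ae_of_all _ hC)
  have hE := integrable_exp_of_abs_le (μ := μ) hS hC
  have hWi : Integrable W μ := Integrable.of_bound hW.aestronglyMeasurable 1
    (ae_of_all _ fun x => by rw [Real.norm_of_nonneg (hW0 x)]; exact hW1 x)
  have hEW := integrable_exp_mul_of_abs_le (μ := μ) hS hC hW hW0 hW1
  have h1 : ∫ x, Real.exp (S x) ∂μ = 1 := by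
    simpa using (integral_withDensity_exp hS hμ fun _ => 1).symm
  have hA : Integrable (fun x => (1 / (4 * s) + s / 2 + 1 / 2) * Real.exp (S x)) μ :=
    hE.const_mul _
  have hB : Integrable (fun x => (1 / (4 * s)) * S x) μ := hSi.const_mul _
  have hAB : Integrable (fun x => (1 / (4 * s) + s / 2 + 1 / 2) * Real.exp (S x)
      - (1 / (4 * s)) * S x) μ := hA.sub hB
  have hABc : Integrable (fun x => (1 / (4 * s) + s / 2 + 1 / 2) * Real.exp (S x)
      - (1 / (4 * s)) * S x + (s / 2 - 1 / (4 * s) - 1 / 2)) μ := hAB.add (integrable_const _)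
  have hint : ∫ x, (W x + ((1 / (4 * s) + s / 2 + 1 / 2) * Real.exp (S x)
      - (1 / (4 * s)) * S x + (s / 2 - 1 / (4 * s) - 1 / 2))) ∂μ
      = ∫ x, W x ∂μ + s - (∫ x, S x ∂μ) / (4 * s) := by
    rw [integral_add hWi hABc, integral_add hAB (integrable_const _), integral_sub hA hB, integral_const_mul,
      integral_const_mul, h1]
    simp only [integral_const, probReal_univ, smul_eq_mul, one_mul]
    ring
  rw [integral_withDensity_exp hS hμ, ← hint]
  refine integral_mono hEW (hWi.add hABc) fun x => ?_
  -- With `r = exp (S / 2)`, a Hellinger argument: `|1 - r ^ 2| = |1 - r| * (1 + r)` is split by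
  -- AM-GM with weight `s`, and `(1 - r) ^ 2 ≤ r ^ 2 - 1 - S` has integral at most the relative
  -- entropy.
  have hr : 1 + S x / 2 ≤ Real.exp (S x / 2) := by linarith [Real.add_one_le_exp (S x / 2)]
  have hr2 : Real.exp (S x) = Real.exp (S x / 2) ^ 2 := by
    rw [← Real.exp_nat_mul]; congr 1; push_cast; ring
  have hr0 := Real.exp_pos (S x / 2)
  simp only [hr2]
  generalize Real.exp (S x / 2) = r at *
  have h2 : W x * (r ^ 2 - 1) ≤ (|1 - r ^ 2| + r ^ 2 - 1) / 2 := by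
    rcases le_total (1 : ℝ) (r ^ 2) with h | h
    · rw [abs_of_nonpos (by linarith)]; nlinarith [hW1 x]
    · rw [abs_of_nonneg (by linarith)]; nlinarith [hW0 x]
  have h3 : |1 - r ^ 2| ≤ (1 - r) ^ 2 / (2 * s) + s * (1 + r) ^ 2 / 2 := by
    have e : (1 - r) ^ 2 / (2 * s) + s * (1 + r) ^ 2 / 2 - |1 - r| * (1 + r)
        = (|1 - r| - s * (1 + r)) ^ 2 / (2 * s) := by
      rw [← sq_abs (1 - r)]; field_simp; ring
    have e2 : |1 - r ^ 2| = |1 - r| * (1 + r) := by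
      rw [show 1 - r ^ 2 = (1 - r) * (1 + r) by ring, abs_mul,
        abs_of_pos (show 0 < 1 + r by linarith)]
    have : 0 ≤ (|1 - r| - s * (1 + r)) ^ 2 / (2 * s) := by positivity
    linarith
  have h4 : (1 - r) ^ 2 / (2 * s) ≤ (1 / (2 * s)) * (r ^ 2 - 1 - S x) := by
    rw [div_eq_mul_one_div, mul_comm]
    refine mul_le_mul_of_nonneg_left (by linarith) (by positivity)
  have h5 : s * (1 + r) ^ 2 / 2 ≤ s * (1 + r ^ 2) := by
    nlinarith [mul_nonneg hs.le (sq_nonneg (1 - r))]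
  have h6 : 1 / (2 * s) = 2 * (1 / (4 * s)) := by field_simp; norm_num
  rw [h6] at h4
  linarith

end ChangeOfMeasure

/-! ### Scaled Bernoulli arms -/

section Bernoulli

/-- The law of `b` times a Bernoulli variable with parameter `p`. -/
def scaledBernoulli (b : ℝ) (p : Set.Icc (0 : ℝ) 1) : ProbabilityMeasure ℝ :=
  ⟨ENNReal.ofReal (1 - p) • Measure.dirac 0 + ENNReal.ofReal p • Measure.dirac b, ⟨by
    simp only [Measure.coe_add, Measure.coe_smul, Pi.add_apply, Pi.smul_apply, measure_univ,
      smul_eq_mul, mul_one]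
    rw [← ENNReal.ofReal_add (sub_nonneg.2 p.2.2) p.2.1]
    simp⟩⟩

variable {b : ℝ} {p q : Set.Icc (0 : ℝ) 1}

lemma coe_scaledBernoulli : (scaledBernoulli b p : Measure ℝ) =
    ENNReal.ofReal (1 - p) • Measure.dirac 0 + ENNReal.ofReal p • Measure.dirac b := rfl

lemma isScaledBernoulli_scaledBernoulli : IsScaledBernoulli b (scaledBernoulli b p) :=
  ⟨p, p.2.1, p.2.2, rfl⟩

lemma integral_scaledBernoulli (g : ℝ → ℝ) :
    ∫ x, g x ∂(scaledBernoulli b p : Measure ℝ) = (1 - p) * g 0 + p * g b := by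
  have hd (c : ℝ) : Integrable g (Measure.dirac c) := integrable_dirac (by simp)
  rw [coe_scaledBernoulli, integral_add_measure ((hd _).smul_measure ENNReal.ofReal_ne_top)
    ((hd _).smul_measure ENNReal.ofReal_ne_top)]
  simp [integral_smul_measure, ENNReal.toReal_ofReal, p.2.1, p.2.2]

lemma armMean_scaledBernoulli : armMean (scaledBernoulli b p) = p * b := by
  rw [armMean, integral_scaledBernoulli]; ring

lemma momentBound_scaledBernoulli {ε u : ℝ} (hε : 0 < ε) (hb : 0 ≤ b)
    (h : p * b ^ (1 + ε) ≤ u) : MomentBound ε u (scaledBernoulli b p) := by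
  rw [MomentBound, coe_scaledBernoulli, lintegral_add_measure, lintegral_smul_measure,
    lintegral_smul_measure, lintegral_dirac, lintegral_dirac, abs_zero,
    Real.zero_rpow (by linarith), abs_of_nonneg hb]
  simp only [ENNReal.ofReal_zero, smul_eq_mul, mul_zero, zero_add]
  rw [← ENNReal.ofReal_mul p.2.1]
  exact ENNReal.ofReal_le_ofReal h

/-- The relative entropy of two Bernoulli distributions. -/
def bernoulliKL (p q : ℝ) : ℝ := p * Real.log (p / q) + (1 - p) * Real.log ((1 - p) / (1 - q))

/-- The log-likelihood ratio of two scaled Bernoulli distributions. -/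
def logRatio (b p q x : ℝ) : ℝ :=
  if x = b then Real.log (q / p) else Real.log ((1 - q) / (1 - p))

lemma measurable_logRatio (b p q : ℝ) : Measurable (logRatio b p q) :=
  Measurable.ite (measurableSet_singleton b) measurable_const measurable_const

lemma abs_logRatio_le (b p q x : ℝ) :
    |logRatio b p q x| ≤ |Real.log (q / p)| + |Real.log ((1 - q) / (1 - p))| := by
  unfold logRatio
  split_ifs
  · linarith [abs_nonneg (Real.log ((1 - q) / (1 - p)))]
  · linarith [abs_nonneg (Real.log (q / p))]

lemma integral_logRatio (hb : b ≠ 0) :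
    ∫ x, logRatio b p q x ∂(scaledBernoulli b p : Measure ℝ) = - bernoulliKL p q := by
  rw [integral_scaledBernoulli, logRatio, logRatio, if_neg hb.symm, if_pos rfl, bernoulliKL,
    ← inv_div (p : ℝ) q, ← inv_div (1 - (p : ℝ)), Real.log_inv, Real.log_inv]
  ring

/-- Only the atoms `0` and `b` carry mass, so the value that `logRatio` takes elsewhere is
immaterial; `b ≠ 0` keeps the two atoms apart. -/
lemma scaledBernoulli_withDensity (hb : b ≠ 0) (hp0 : 0 < (p : ℝ)) (hp1 : (p : ℝ) < 1)
    (hq0 : 0 < (q : ℝ)) (hq1 : (q : ℝ) < 1) :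
    (scaledBernoulli b q : Measure ℝ) = (scaledBernoulli b p : Measure ℝ).withDensity
      fun x => ENNReal.ofReal (Real.exp (logRatio b p q x)) := by
  have hm : Measurable fun x => ENNReal.ofReal (Real.exp (logRatio b p q x)) :=
    (measurable_logRatio b p q).exp.ennreal_ofReal
  refine Measure.ext_of_lintegral _ fun f hf => ?_
  rw [lintegral_withDensity_eq_lintegral_mul _ hm hf, coe_scaledBernoulli, coe_scaledBernoulli]
  simp only [lintegral_add_measure, lintegral_smul_measure, lintegral_dirac, Pi.mul_apply,
    smul_eq_mul, logRatio, if_neg hb.symm, if_true]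
  rw [Real.exp_log (div_pos hq0 hp0), Real.exp_log (div_pos (sub_pos.2 hq1) (sub_pos.2 hp1)),
    ← mul_assoc, ← mul_assoc, ← ENNReal.ofReal_mul p.2.1,
    ← ENNReal.ofReal_mul (sub_nonneg.2 p.2.2), mul_div_cancel₀ _ hp0.ne',
    mul_div_cancel₀ _ (sub_pos.2 hp1).ne']

end Bernoulli

/-! ### Changing one arm of a bandit -/

section Bandit

variable {V : Type*} [Fintype V] {K : ℕ} (P : CentralizedPolicy V K)
  {ν : Fin K → ProbabilityMeasure ℝ} {b : ℝ} {p q : Set.Icc (0 : ℝ) 1}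

/-- The log-likelihood ratio of two bandit problems that differ in a scaled Bernoulli arm `j`. -/
def armLogRatio (j : Fin K) (b p q : ℝ) (z : Fin K × ℝ) : ℝ :=
  if z.1 = j then logRatio b p q z.2 else 0

lemma measurable_armLogRatio (j : Fin K) (b p q : ℝ) : Measurable (armLogRatio j b p q) :=
  Measurable.ite (measurableSet_eq_fun measurable_fst measurable_const)
    ((measurable_logRatio b p q).comp measurable_snd) measurable_const

lemma abs_armLogRatio_le (j : Fin K) (b p q : ℝ) (z : Fin K × ℝ) :
    |armLogRatio j b p q z| ≤ |Real.log (q / p)| + |Real.log ((1 - q) / (1 - p))| := by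
  unfold armLogRatio
  split_ifs
  · exact abs_logRatio_le _ _ _ _
  · rw [abs_zero]; positivity

variable {j : Fin K}

lemma update_withDensity (hb : b ≠ 0) (hp0 : 0 < (p : ℝ)) (hp1 : (p : ℝ) < 1)
    (hq0 : 0 < (q : ℝ)) (hq1 : (q : ℝ) < 1) (hj : ν j = scaledBernoulli b p) (k : Fin K) :
    (Function.update ν j (scaledBernoulli b q) k : Measure ℝ)
      = (ν k : Measure ℝ).withDensity
        fun x => ENNReal.ofReal (Real.exp (armLogRatio j b p q (k, x))) := by
  rcases eq_or_ne k j with rfl | hk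
  · simp only [Function.update_self, hj, armLogRatio, if_true]
    exact scaledBernoulli_withDensity hb hp0 hp1 hq0 hq1
  · simp [armLogRatio, hk]

lemma integral_score_armLogRatio (hb : b ≠ 0) (hj : ν j = scaledBernoulli b p) (T : ℕ) :
    ∫ h, score (armLogRatio j b p q) h ∂(P.law ν T)
      = - (bernoulliKL p q * P.expectedPulls ν j T) := by
  rw [integral_score P ν (measurable_armLogRatio j b p q) (abs_armLogRatio_le j b p q),
    Finset.sum_eq_single j]
  · simp only [armLogRatio, if_true, hj, integral_logRatio hb]; ring
  · intro k _ hk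
    simp [armLogRatio, hk]
  · simp

/-- If the parameter of a scaled Bernoulli arm is changed, then an event that is likely before and
unlikely after the change requires many pulls of this arm. -/
lemma exp_neg_le_add (hb : b ≠ 0) (hp0 : 0 < (p : ℝ)) (hp1 : (p : ℝ) < 1)
    (hq0 : 0 < (q : ℝ)) (hq1 : (q : ℝ) < 1) (hj : ν j = scaledBernoulli b p) (T : ℕ)
    {W : Hist V K T → ℝ} (hW : Measurable W) (hW0 : ∀ x, 0 ≤ W x) (hW1 : ∀ x, W x ≤ 1) :
    Real.exp (- (bernoulliKL p q * P.expectedPulls ν j T) - 1) ≤ ∫ h, W h ∂(P.law ν T)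
      + ∫ h, (1 - W h) ∂(P.law (Function.update ν j (scaledBernoulli b q)) T) := by
  rw [← integral_score_armLogRatio P hb hj]
  exact exp_integral_sub_one_le (measurable_score (measurable_armLogRatio j b p q))
    (abs_score_le (abs_armLogRatio_le j b p q))
    (law_withDensity P (measurable_armLogRatio j b p q)
      (update_withDensity hb hp0 hp1 hq0 hq1 hj) T) hW hW0 hW1

/-- The Pinsker counterpart of `exp_neg_le_add`, suited to a relative entropy that stays bounded.
The free `s` replaces the square root. -/
lemma integral_update_le (hb : b ≠ 0) (hp0 : 0 < (p : ℝ)) (hp1 : (p : ℝ) < 1)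
    (hq0 : 0 < (q : ℝ)) (hq1 : (q : ℝ) < 1) (hj : ν j = scaledBernoulli b p) (T : ℕ)
    {W : Hist V K T → ℝ} (hW : Measurable W) (hW0 : ∀ x, 0 ≤ W x) (hW1 : ∀ x, W x ≤ 1)
    {s : ℝ} (hs : 0 < s) :
    ∫ h, W h ∂(P.law (Function.update ν j (scaledBernoulli b q)) T) ≤ ∫ h, W h ∂(P.law ν T)
      + s + bernoulliKL p q * P.expectedPulls ν j T / (4 * s) := by
  have := integral_le_integral_add (measurable_score (measurable_armLogRatio j b p q))
    (abs_score_le (abs_armLogRatio_le j b p q))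
    (law_withDensity P (measurable_armLogRatio j b p q)
      (update_withDensity hb hp0 hp1 hq0 hq1 hj) T) hW hW0 hW1 hs
  rw [integral_score_armLogRatio P hb hj, neg_div, sub_neg_eq_add] at this
  exact this

end Bandit

/-! ### Numerical bounds on the Bernoulli relative entropy -/

section Entropy

lemma bernoulliKL_half_le {q : ℝ} (hq0 : 0 < q) (hq1 : q ≤ 1 / 4) :
    bernoulliKL (q / 2) q ≤ q / 3 := by
  have h1 : Real.log (q / 2 / q) ≤ q / 2 / q - 1 := Real.log_le_sub_one_of_pos (by positivity)
  have h2 : Real.log ((1 - q / 2) / (1 - q)) ≤ (1 - q / 2) / (1 - q) - 1 :=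
    Real.log_le_sub_one_of_pos (div_pos (by linarith) (by linarith))
  -- The two terms contribute `-q / 4` and `7 / 12 * q`; the constant `7 / 12` is attained at `q = 1
  -- / 4`.
  have e1 : q / 2 / q - 1 = -(1 / 2) := by field_simp; norm_num
  have e2 : (1 - q / 2) * ((1 - q / 2) / (1 - q) - 1) ≤ 7 / 12 * q := by
    have hQ : 0 < 1 - q := by linarith
    rw [div_sub_one hQ.ne', ← mul_div_assoc, div_le_iff₀ hQ]
    nlinarith
  have h3 := mul_le_mul_of_nonneg_left (h1.trans_eq e1) (by positivity : 0 ≤ q / 2)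
  have h4 := mul_le_mul_of_nonneg_left h2 (by linarith : 0 ≤ 1 - q / 2)
  unfold bernoulliKL
  linarith

lemma log_le_sub_inv_div_two {r : ℝ} (hr : 1 ≤ r) : Real.log r ≤ (r - r⁻¹) / 2 := by
  rw [← Real.sinh_log (by linarith)]
  exact Real.self_le_sinh_iff.2 (Real.log_nonneg hr)

/-- The constant must lie below `1 / 4` for the sharp rate in (1). Using `log r ≤ r - 1` for the
second logarithm would miss this at `q = 1 / 4`, hence the sharper `log_le_sub_inv_div_two`. -/
lemma bernoulliKL_le {q : ℝ} (hq0 : 0 < q) (hq1 : q ≤ 1 / 4) :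
    bernoulliKL (12 / 25 * q) q ≤ 11 / 50 * q := by
  have h1 : Real.log (12 / 25 * q / q) ≤ - (73 / 100) := by
    rw [mul_div_cancel_right₀ _ hq0.ne', show (12 / 25 : ℝ) = 2⁻¹ * (24 / 25) by norm_num,
      Real.log_mul (by norm_num) (by norm_num), Real.log_inv]
    have := Real.log_le_sub_one_of_pos (show (0 : ℝ) < 24 / 25 by norm_num)
    linarith [Real.log_two_gt_d9]
  have hQ : 0 < 1 - q := by linarith
  have hP : 0 < 1 - 12 / 25 * q := by linarith
  have h2 := log_le_sub_inv_div_two (r := (1 - 12 / 25 * q) / (1 - q))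
    ((one_le_div hQ).2 (by linarith))
  have h3 : (1 - 12 / 25 * q) * (((1 - 12 / 25 * q) / (1 - q)
      - ((1 - 12 / 25 * q) / (1 - q))⁻¹) / 2) ≤ 57 / 100 * q := by
    have e : (1 - 12 / 25 * q) * (((1 - 12 / 25 * q) / (1 - q)
      - ((1 - 12 / 25 * q) / (1 - q))⁻¹) / 2)
        = ((1 - 12 / 25 * q) ^ 2 - (1 - q) ^ 2) / (2 * (1 - q)) := by
      rw [inv_div]
      generalize 1 - 12 / 25 * q = x at *
      generalize 1 - q = y at *
      field_simp
    rw [e, div_le_iff₀ (by linarith)]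
    nlinarith
  have h4 := mul_le_mul_of_nonneg_left h2 hP.le
  have h5 := mul_le_mul_of_nonneg_left h1 (by positivity : 0 ≤ 12 / 25 * q)
  unfold bernoulliKL
  linarith

end Entropy

/-! ### From pull counts to regret -/

section Regret

variable {V : Type*} [Fintype V] {K : ℕ} (P : CentralizedPolicy V K)
  {ν : Fin K → ProbabilityMeasure ℝ} {b : ℝ} {p q : Set.Icc (0 : ℝ) 1} {j : Fin K}

lemma armMean_le_bestMean (ν : Fin K → ProbabilityMeasure ℝ) (k : Fin K) :
    armMean (ν k) ≤ bestMean ν :=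
  le_ciSup (f := fun k => armMean (ν k)) (Set.finite_range _).bddAbove k

lemma bestMean_eq (h : ∀ k, armMean (ν k) ≤ armMean (ν j)) : bestMean ν = armMean (ν j) :=
  have : Nonempty (Fin K) := ⟨j⟩
  le_antisymm (ciSup_le h) (armMean_le_bestMean ν j)

/-- The regret when all arms but the best arm `j` have gap `Δ`. -/
lemma groupRegret_eq_of_gap {Δ : ℝ} (hΔ : 0 ≤ Δ)
    (h : ∀ k, k ≠ j → armMean (ν j) - armMean (ν k) = Δ) (T : ℕ) :
    P.groupRegret ν T = ∑ k ∈ Finset.univ.erase j, Δ * P.expectedPulls ν k T := by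
  have hb : bestMean ν = armMean (ν j) := by
    refine bestMean_eq fun k => ?_
    rcases eq_or_ne k j with rfl | hk
    · exact le_rfl
    · linarith [h k hk]
  rw [groupRegret_eq, ← Finset.add_sum_erase _ _ (Finset.mem_univ j), hb, sub_self, zero_mul,
    zero_add]
  exact Finset.sum_congr rfl fun k hk => by rw [h k (Finset.ne_of_mem_erase hk)]

lemma sum_erase_expectedPulls (ν : Fin K → ProbabilityMeasure ℝ) (j : Fin K) (T : ℕ) :
    ∑ k ∈ Finset.univ.erase j, P.expectedPulls ν k T
      = T * Fintype.card V - P.expectedPulls ν j T := by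
  rw [← sum_expectedPulls P ν T, ← Finset.add_sum_erase _ _ (Finset.mem_univ j)]
  ring

lemma integral_pulls_div (ν : Fin K → ProbabilityMeasure ℝ) (j : Fin K) (T : ℕ) (N : ℝ) :
    ∫ h, (pulls j h : ℝ) / N ∂(P.law ν T) = P.expectedPulls ν j T / N :=
  integral_div _ _

/-- The asymptotic lower bound on the number of pulls of a suboptimal scaled Bernoulli arm. -/
lemma eventually_log_le [Nonempty V] {ε u : ℝ} (hP : P.IsConsistent ε u)
    (hν : ∀ k, MomentBound ε u (ν k)) (hb : b ≠ 0) (hp0 : 0 < (p : ℝ)) (hp1 : (p : ℝ) < 1)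
    (hq0 : 0 < (q : ℝ)) (hq1 : (q : ℝ) < 1) (hj : ν j = scaledBernoulli b p)
    (hsub : armMean (ν j) < bestMean ν) (hq : MomentBound ε u (scaledBernoulli b q))
    (hopt : ∀ k, k ≠ j → armMean (ν k) < armMean (scaledBernoulli b q)) {a : ℝ} (ha : 0 < a) :
    ∀ᶠ T : ℕ in atTop,
      (1 - a) * Real.log T - 1 ≤ bernoulliKL p q * P.expectedPulls ν j T := by
  set ν' := Function.update ν j (scaledBernoulli b q) with hν'
  have hν'm (k : Fin K) : MomentBound ε u (ν' k) := by
    rcases eq_or_ne k j with rfl | hk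
    · simpa [hν'] using hq
    · simpa [hν', Function.update_of_ne hk] using hν k
  have hν's (k : Fin K) (hk : k ≠ j) : armMean (ν' k) < bestMean ν' := by
    refine lt_of_lt_of_le ?_ (armMean_le_bestMean ν' j)
    simpa [hν', Function.update_of_ne hk] using hopt k hk
  -- Arm `j` is suboptimal under `ν` and every other arm is suboptimal under `ν'`, so consistency
  -- controls all these pulls.
  have ho : (fun T : ℕ => P.expectedPulls ν j T + ∑ k ∈ Finset.univ.erase j,
      P.expectedPulls ν' k T) =o[atTop] fun T : ℕ => (T : ℝ) ^ a :=
    (hP ν hν j hsub a ha).add (Asymptotics.IsLittleO.fun_sum fun k hk =>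
      hP ν' hν'm k (hν's k (Finset.ne_of_mem_erase hk)) a ha)
  filter_upwards [ho.bound one_pos, eventually_ge_atTop 1] with T hT hT1
  have hT0 : (0 : ℝ) < T := by exact_mod_cast hT1
  have hV : (1 : ℝ) ≤ Fintype.card V := by exact_mod_cast Fintype.card_pos
  set N : ℝ := T * Fintype.card V with hN
  have hTN : (T : ℝ) ≤ N := le_mul_of_one_le_right hT0.le hV
  have hN0 : 0 < N := hT0.trans_le hTN
  rw [Real.norm_eq_abs, Real.norm_of_nonneg (by positivity), one_mul] at hT
  have hW1 (h : Hist V K T) : (pulls j h : ℝ) / N ≤ 1 := (div_le_one hN0).2 (pulls_le j h)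
  have key := exp_neg_le_add P hb hp0 hp1 hq0 hq1 hj T ((measurable_pulls j).div_const N)
    (fun h => by positivity) hW1
  rw [← hν', integral_sub (integrable_const _) ((integrable_pulls j _).div_const N),
    integral_pulls_div, integral_pulls_div] at key
  simp only [integral_const, probReal_univ, smul_eq_mul, one_mul] at key
  have h1 : P.expectedPulls ν j T / N + (1 - P.expectedPulls ν' j T / N) ≤ (T : ℝ) ^ a / T := by
    have e : P.expectedPulls ν j T / N + (1 - P.expectedPulls ν' j T / N)
        = (P.expectedPulls ν j T + ∑ k ∈ Finset.univ.erase j, P.expectedPulls ν' k T) / N := by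
      rw [sum_erase_expectedPulls, ← hN]; field_simp
    rw [e]
    refine div_le_div₀ (by positivity) ((le_abs_self _).trans hT) hT0 hTN
  have h2 := Real.log_le_log (Real.exp_pos _) (key.trans h1)
  rw [Real.log_exp, Real.log_div (by positivity) hT0.ne', Real.log_rpow hT0] at h2
  linarith

/-- The minimax lower bound for scaled Bernoulli arms and a short horizon. -/
lemma exists_sum_expectedPulls_ge (hK : 2 ≤ K) (hb : b ≠ 0) (hq0 : 0 < (q : ℝ))
    (hq1 : (q : ℝ) ≤ 1 / 4) (hpq : (p : ℝ) = q / 2) (T : ℕ) (hT : 0 < (T * Fintype.card V : ℝ))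
    (hqT : (q : ℝ) * (T * Fintype.card V) ≤ (K : ℝ) / 8) :
    ∃ j : Fin K, (T * Fintype.card V : ℝ) / 4 ≤ ∑ k ∈ Finset.univ.erase j,
      P.expectedPulls
        (Function.update (fun _ => scaledBernoulli b p) j (scaledBernoulli b q)) k T := by
  set N : ℝ := T * Fintype.card V with hN
  have hK0 : (2 : ℝ) ≤ K := by exact_mod_cast hK
  -- Pigeonhole: the `N` pulls are spread over `K` identical arms.
  obtain ⟨j, -, hj⟩ : ∃ j ∈ (Finset.univ : Finset (Fin K)),
      P.expectedPulls (fun _ => scaledBernoulli b p) j T ≤ N / K := by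
    refine Finset.exists_le_of_sum_le ⟨⟨0, by omega⟩, Finset.mem_univ _⟩ ?_
    rw [sum_expectedPulls, Finset.sum_const, Finset.card_univ, Fintype.card_fin, nsmul_eq_mul,
      mul_div_cancel₀ _ (by positivity)]
  refine ⟨j, ?_⟩
  rw [sum_erase_expectedPulls, ← hN]
  have key := integral_update_le P (ν := fun _ => scaledBernoulli b p) (q := q) hb
    (by rw [hpq]; linarith) (by rw [hpq]; linarith) hq0 (by linarith) (j := j) rfl T
    ((measurable_pulls j).div_const N) (fun h => by positivity)
    (fun h => (div_le_one hT).2 (pulls_le j h)) (show (0 : ℝ) < 1 / 8 by norm_num)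
  rw [integral_pulls_div, integral_pulls_div, hpq] at key
  set E := P.expectedPulls (fun _ => scaledBernoulli b p) j T with hE
  have hE0 : 0 ≤ E := expectedPulls_nonneg P _ j T
  have h1 : E / N ≤ 1 / 2 := by
    rw [div_le_iff₀ hT]
    refine hj.trans ?_
    rw [div_le_iff₀ (by linarith)]
    nlinarith
  have h2 : bernoulliKL (q / 2) q * E ≤ 1 / 24 := by
    calc _ ≤ (q / 3 : ℝ) * (N / K) := mul_le_mul (bernoulliKL_half_le hq0 hq1) hj hE0 (by positivity)
      _ = q * N / (3 * K) := by ring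
      _ ≤ (K / 8) / (3 * K) := by gcongr
      _ = 1 / 24 := by field_simp; norm_num
  -- The share of `j` is at most `1/2` (as `K ≥ 2`), plus `s = 1/8`, plus `1/12` from the relative
  -- entropy.
  have h3 : P.expectedPulls (Function.update (fun _ => scaledBernoulli b p) j
      (scaledBernoulli b q)) j T / N ≤ 3 / 4 := by
    have h4 : bernoulliKL (q / 2) q * E / (4 * (1 / 8)) ≤ 1 / 12 := by
      rw [div_le_iff₀ (by norm_num)]
      exact h2.trans_eq (by norm_num)
    refine key.trans ?_
    linarith
  rw [div_le_iff₀ hT] at h3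
  linarith

end Regret

/-! ### The two lower bounds -/

section LowerBounds

theorem exists_instance_dependent_lower_bound {ε u Δ : ℝ} {K : ℕ} (hε : 0 < ε) (hε1 : ε ≤ 1)
    (hu : 1 ≤ u) (hΔ : 0 < Δ) (hΔ1 : Δ < 1 / 4) (kstar : Fin K) :
    ∃ ν : Fin K → ProbabilityMeasure ℝ,
      (∃ b : ℝ, 0 < b ∧ ∀ k, IsScaledBernoulli b (ν k)) ∧
      (∀ k, MomentBound ε u (ν k)) ∧
      (∀ k, k ≠ kstar → armMean (ν kstar) - armMean (ν k) = Δ) ∧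
      ∀ (V : Type) [Fintype V] [Nonempty V] (P : CentralizedPolicy V K), P.IsConsistent ε u →
        ∀ᶠ T : ℕ in atTop,
          (∑ _k ∈ Finset.univ.erase kstar, (2 : ℝ) ^ (1 - 1 / ε) * Δ ^ (-(1 / ε)))
            * Real.log T ≤ P.groupRegret ν T := by
  -- With `b = γ⁻¹` and `Q = γ ^ (1 + ε)`, parameter `Q` has moment `1` and mean `2 * Δ`.
  set γ : ℝ := (2 * Δ) ^ (1 / ε) with hγ
  have hγ0 : 0 < γ := by positivity
  have hγε : γ ^ ε = 2 * Δ := by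
    rw [hγ, ← Real.rpow_mul (by positivity), one_div_mul_cancel hε.ne', Real.rpow_one]
  have hγ1 : γ ≤ 2 * Δ := by
    calc γ ≤ (2 * Δ) ^ (1 : ℝ) := Real.rpow_le_rpow_of_exponent_ge (by positivity) (by linarith)
          ((one_le_div hε).2 hε1)
      _ = 2 * Δ := Real.rpow_one _
  set Q : ℝ := γ * (2 * Δ) with hQ
  have hQ0 : 0 < Q := by positivity
  have hQ1 : Q ≤ 1 / 4 := by nlinarith
  have hQb : Q * (γ⁻¹) ^ (1 + ε) = 1 := by
    rw [Real.inv_rpow hγ0.le, Real.rpow_add hγ0, Real.rpow_one, hγε, hQ]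
    exact mul_inv_cancel₀ (by positivity)
  have hQγ : Q * γ⁻¹ = 2 * Δ := by rw [hQ]; field_simp
  have hrate : (2 : ℝ) ^ (1 - 1 / ε) * Δ ^ (-(1 / ε)) = 2 * γ⁻¹ := by
    rw [hγ, ← Real.rpow_neg (by positivity), Real.mul_rpow (by norm_num) hΔ.le,
      sub_eq_add_neg, Real.rpow_add (by norm_num), Real.rpow_one, mul_assoc]
  have hmem (c : ℝ) (hc0 : 0 ≤ c) (hc1 : c ≤ 1) : c * Q ∈ Set.Icc (0 : ℝ) 1 :=
    ⟨by positivity, by nlinarith⟩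
  -- The best arm sits at `49/50 * Q`, just below the moment limit, so that an arm raised to `Q`
  -- becomes strictly best; `49/50 - 12/25 = 1/2` makes the gap exactly `Δ`.
  set p : Set.Icc (0 : ℝ) 1 := ⟨12 / 25 * Q, hmem _ (by norm_num) (by norm_num)⟩ with hp
  set p' : Set.Icc (0 : ℝ) 1 := ⟨49 / 50 * Q, hmem _ (by norm_num) (by norm_num)⟩ with hp'
  set q : Set.Icc (0 : ℝ) 1 := ⟨Q, hQ0.le, by linarith⟩ with hq
  have hγi : 0 < γ⁻¹ := inv_pos.2 hγ0
  have hmom (r : Set.Icc (0 : ℝ) 1) (hr : (r : ℝ) ≤ Q) :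
      MomentBound ε u (scaledBernoulli γ⁻¹ r) := by
    refine momentBound_scaledBernoulli hε hγi.le (le_trans ?_ hu)
    exact (mul_le_mul_of_nonneg_right hr (by positivity)).trans_eq hQb
  set ν : Fin K → ProbabilityMeasure ℝ :=
    fun k => if k = kstar then scaledBernoulli γ⁻¹ p' else scaledBernoulli γ⁻¹ p with hν
  have hνs : ν kstar = scaledBernoulli γ⁻¹ p' := if_pos rfl
  have hνk (k : Fin K) (hk : k ≠ kstar) : ν k = scaledBernoulli γ⁻¹ p := if_neg hk
  have hνm (k : Fin K) : MomentBound ε u (ν k) := by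
    rcases eq_or_ne k kstar with rfl | hk
    · rw [hνs]; exact hmom _ (by simp only [hp']; linarith)
    · rw [hνk k hk]; exact hmom _ (by simp only [hp]; linarith)
  have hgap (k : Fin K) (hk : k ≠ kstar) : armMean (ν kstar) - armMean (ν k) = Δ := by
    rw [hνs, hνk k hk, armMean_scaledBernoulli, armMean_scaledBernoulli]
    simp only [hp, hp']
    linear_combination (1 / 2) * hQγ
  refine ⟨ν, ⟨γ⁻¹, hγi, fun k => ?_⟩, hνm, hgap, fun V _ _ P hP => ?_⟩
  · rcases eq_or_ne k kstar with rfl | hk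
    · rw [hνs]; exact isScaledBernoulli_scaledBernoulli
    · rw [hνk k hk]; exact isScaledBernoulli_scaledBernoulli
  have hpulls (k : Fin K) (hk : k ≠ kstar) : ∀ᶠ T : ℕ in atTop,
      2 * γ⁻¹ * Real.log T ≤ Δ * P.expectedPulls ν k T := by
    have h := eventually_log_le P (b := γ⁻¹) (p := p) (q := q) (j := k) hP hνm hγi.ne'
      (by simp only [hp]; positivity) (by simp only [hp]; linarith) hQ0 (by simp only [hq]; linarith)
      (hνk k hk) (by linarith [hgap k hk, armMean_le_bestMean ν kstar]) (hmom _ le_rfl)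
      (fun i _ => by
        rw [armMean_scaledBernoulli]
        have hQγ0 : 0 < Q * γ⁻¹ := by positivity
        rcases eq_or_ne i kstar with rfl | hi
        · rw [hνs, armMean_scaledBernoulli]; simp only [hp', hq]; linarith
        · rw [hνk i hi, armMean_scaledBernoulli]; simp only [hp, hq]; linarith)
      (a := 1 / 25) (by norm_num)
    have hlog : Tendsto (fun T : ℕ => Real.log T) atTop atTop :=
      Real.tendsto_log_atTop.comp tendsto_natCast_atTop_atTop
    filter_upwards [h, hlog.eventually_ge_atTop 20] with T hT hT20
    have h1 := mul_le_mul_of_nonneg_right (bernoulliKL_le hQ0 hQ1) (expectedPulls_nonneg P ν k T)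
    -- Since `4 * 11/50 = 22/25 < 24/25 = 1 - a`, the slack `2/25 * log T` absorbs the constant `1`.
    have h2 : 4 * Real.log T ≤ Q * P.expectedPulls ν k T := by
      have := hT.trans h1
      linarith
    calc 2 * γ⁻¹ * Real.log T = γ⁻¹ / 2 * (4 * Real.log T) := by ring
      _ ≤ γ⁻¹ / 2 * (Q * P.expectedPulls ν k T) := by gcongr
      _ = (Q * γ⁻¹) / 2 * P.expectedPulls ν k T := by ring
      _ = Δ * P.expectedPulls ν k T := by rw [hQγ]; ring
  have hall : ∀ᶠ T : ℕ in atTop, ∀ k ∈ Finset.univ.erase kstar,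
      2 * γ⁻¹ * Real.log T ≤ Δ * P.expectedPulls ν k T :=
    (Finset.eventually_all _).2 fun k hk => hpulls k (Finset.ne_of_mem_erase hk)
  filter_upwards [hall] with T hT
  rw [groupRegret_eq_of_gap P hΔ.le hgap, Finset.sum_mul]
  simp only [hrate]
  exact Finset.sum_le_sum hT

theorem exists_minimax_lower_bound {ε u : ℝ} {K T : ℕ} (hε : 0 < ε) (hu : 1 ≤ u)
    (hK : 2 ≤ K) (hKT : K ≤ T) :
    ∃ ν : Fin K → ProbabilityMeasure ℝ, (∀ k, MomentBound ε u (ν k)) ∧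
      ∀ M : ℕ, 1 ≤ M → M ≤ K → ∀ P : CentralizedPolicy (Fin M) K, ∃ σ : Equiv.Perm (Fin K),
        1 / 128 * (K : ℝ) ^ (ε / (1 + ε)) * (T : ℝ) ^ (1 / (1 + ε))
          ≤ P.groupRegret (fun k => ν (σ k)) T := by
  have hK0 : (2 : ℝ) ≤ K := by exact_mod_cast hK
  have hKT' : (K : ℝ) ≤ T := by exact_mod_cast hKT
  have hT0 : (0 : ℝ) < T := by linarith
  -- At this scale `T / K` pulls of an arm carry only bounded information.
  set Q : ℝ := K / (8 * T) with hQ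
  have hQ0 : 0 < Q := by positivity
  have hQ1 : Q ≤ 1 / 8 := by rw [hQ, div_le_iff₀ (by positivity)]; linarith
  have hQT : Q * T = K / 8 := by rw [hQ]; field_simp
  set γ : ℝ := Q ^ (1 / (1 + ε)) with hγ
  have hγ0 : 0 < γ := by positivity
  have hγi : 0 < γ⁻¹ := inv_pos.2 hγ0
  have hγε : γ ^ (1 + ε) = Q := by
    rw [hγ, ← Real.rpow_mul hQ0.le, one_div_mul_cancel (by positivity), Real.rpow_one]
  have hQb : Q * (γ⁻¹) ^ (1 + ε) = 1 := by
    rw [Real.inv_rpow hγ0.le, hγε, mul_inv_cancel₀ hQ0.ne']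
  have hrate : 1 / 8 * (K : ℝ) ^ (ε / (1 + ε)) * (T : ℝ) ^ (1 / (1 + ε)) ≤ Q * γ⁻¹ * T := by
    have he : ε / (1 + ε) = 1 - 1 / (1 + ε) := by field_simp; simp
    have he1 : ε / (1 + ε) ≤ 1 := (div_le_one (by positivity)).2 (by linarith)
    have h1 : Q * γ⁻¹ = Q ^ (ε / (1 + ε)) := by
      rw [he, Real.rpow_sub hQ0, Real.rpow_one, ← hγ, div_eq_mul_inv]
    have h2 : Q ^ (ε / (1 + ε)) = (1 / 8) ^ (ε / (1 + ε)) * (K : ℝ) ^ (ε / (1 + ε))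
        / (T : ℝ) ^ (ε / (1 + ε)) := by
      rw [← Real.mul_rpow (by norm_num) (by positivity), ← Real.div_rpow (by positivity) hT0.le]
      congr 1
      rw [hQ]; field_simp
    have h3 : (T : ℝ) ^ (1 / (1 + ε)) = T / (T : ℝ) ^ (ε / (1 + ε)) := by
      rw [show 1 / (1 + ε) = 1 - ε / (1 + ε) by rw [he]; ring, Real.rpow_sub hT0, Real.rpow_one]
    have h4 : (1 / 8 : ℝ) ≤ (1 / 8) ^ (ε / (1 + ε)) := by
      simpa using Real.rpow_le_rpow_of_exponent_ge (x := (1 / 8 : ℝ)) (by norm_num) (by norm_num) he1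
    rw [h1, h2, h3, div_mul_eq_mul_div _ _ (T : ℝ), ← mul_div_assoc]
    gcongr
  set q : Set.Icc (0 : ℝ) 1 := ⟨Q, hQ0.le, by linarith⟩ with hq
  set p : Set.Icc (0 : ℝ) 1 := ⟨Q / 2, by positivity, by linarith⟩ with hp
  have hmom (r : Set.Icc (0 : ℝ) 1) (hr : (r : ℝ) ≤ Q) :
      MomentBound ε u (scaledBernoulli γ⁻¹ r) := by
    refine momentBound_scaledBernoulli hε hγi.le (le_trans ?_ hu)
    exact (mul_le_mul_of_nonneg_right hr (by positivity)).trans_eq hQb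
  set k₀ : Fin K := ⟨0, by omega⟩
  refine ⟨Function.update (fun _ => scaledBernoulli γ⁻¹ p) k₀ (scaledBernoulli γ⁻¹ q),
    fun k => ?_, fun M hM hMK P => ?_⟩
  · rcases eq_or_ne k k₀ with rfl | hk
    · rw [Function.update_self]; exact hmom _ le_rfl
    · rw [Function.update_of_ne hk]; exact hmom _ (by simp only [hp]; linarith)
  -- All `T` rounds contain `M * T` pulls, too many for indistinguishability. The first `T / M`
  -- rounds contain between `T / 2` and `T`, and the regret of later rounds is nonnegative.
  set n : ℕ := T / M with hn
  have hn1 : 1 ≤ n := (Nat.one_le_div_iff (by omega)).2 (hMK.trans hKT)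
  have hnT : n ≤ T := Nat.div_le_self _ _
  have hN1 : (n * M : ℝ) ≤ T := by exact_mod_cast Nat.div_mul_le_self T M
  have hN2 : (T : ℝ) ≤ 2 * (n * M) := by
    have h1 : T < (n + 1) * M := by
      rw [mul_comm]; exact Nat.lt_mul_div_succ T (by omega)
    have h2 : T ≤ 2 * (n * M) := by nlinarith
    exact_mod_cast h2
  obtain ⟨j, hj⟩ := exists_sum_expectedPulls_ge P (b := γ⁻¹) (p := p) (q := q) hK hγi.ne' hQ0
    (by simp only [hq]; linarith) rfl n (by rw [Fintype.card_fin]; linarith)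
    (by
      rw [Fintype.card_fin, ← hQT]
      exact mul_le_mul_of_nonneg_left hN1 hQ0.le)
  rw [Fintype.card_fin] at hj
  set ν' := Function.update (fun _ => scaledBernoulli γ⁻¹ p) j (scaledBernoulli γ⁻¹ q) with hν'
  -- The distributions were fixed before the policy; only the position `j` of the good one depends
  -- on it.
  refine ⟨Equiv.swap k₀ j, ?_⟩
  have hσ : (fun k => Function.update (fun _ => scaledBernoulli γ⁻¹ p) k₀ (scaledBernoulli γ⁻¹ q)
      (Equiv.swap k₀ j k)) = ν' := by
    funext k
    simp only [hν', Function.update_apply, Equiv.swap_apply_eq_iff, Equiv.swap_apply_left]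
  rw [hσ]
  have hgap (k : Fin K) (hk : k ≠ j) : armMean (ν' j) - armMean (ν' k) = Q * γ⁻¹ / 2 := by
    rw [hν', Function.update_self, Function.update_of_ne hk, armMean_scaledBernoulli,
      armMean_scaledBernoulli]
    simp only [hp, hq]
    ring
  rw [groupRegret_eq_of_gap P (by positivity) hgap, ← Finset.mul_sum]
  have hmono : ∑ k ∈ Finset.univ.erase j, P.expectedPulls ν' k n
      ≤ ∑ k ∈ Finset.univ.erase j, P.expectedPulls ν' k T :=
    Finset.sum_le_sum fun k _ => expectedPulls_mono P ν' k hnT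
  calc 1 / 128 * (K : ℝ) ^ (ε / (1 + ε)) * (T : ℝ) ^ (1 / (1 + ε))
      = 1 / 16 * (1 / 8 * (K : ℝ) ^ (ε / (1 + ε)) * (T : ℝ) ^ (1 / (1 + ε))) := by ring
    _ ≤ 1 / 16 * (Q * γ⁻¹ * T) := by gcongr
    _ = Q * γ⁻¹ / 2 * (T / 8) := by ring
    _ ≤ Q * γ⁻¹ / 2 * ∑ k ∈ Finset.univ.erase j, P.expectedPulls ν' k T := by
      gcongr
      linarith

end LowerBounds

end CoopBandit

end

theorem mainTheorem2 :
    (∀ (ε u Δ : ℝ) (K : ℕ), 0 < ε → ε ≤ 1 → 1 ≤ u → 0 < Δ → Δ < 1 / 4 → 2 ≤ K →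
      ∃ (ν : Fin K → ProbabilityMeasure ℝ) (kstar : Fin K),
        (∃ b : ℝ, 0 < b ∧ ∀ k, CoopBandit.IsScaledBernoulli b (ν k)) ∧
        (∀ k, CoopBandit.MomentBound ε u (ν k)) ∧
        (∀ k, k ≠ kstar → CoopBandit.armMean (ν kstar) - CoopBandit.armMean (ν k) = Δ) ∧
        ∀ (M : ℕ) (G : SimpleGraph (Fin M)), G.Connected →
          ∀ P : CoopBandit.DecentralizedPolicy G K, P.toCentralized.IsConsistent ε u →
            ∀ᶠ T : ℕ in atTop,
              (∑ _k ∈ Finset.univ.erase kstar, (2 : ℝ) ^ (1 - 1 / ε) * Δ ^ (-(1 / ε)))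
                  * Real.log T
                ≤ P.toCentralized.groupRegret ν T) ∧
    (∃ c : ℝ, 0 < c ∧
      ∀ (ε u : ℝ) (K T : ℕ), 0 < ε → ε ≤ 1 → 1 ≤ u → 2 ≤ K → K ≤ T →
        ∃ ν : Fin K → ProbabilityMeasure ℝ,
          (∀ k, CoopBandit.MomentBound ε u (ν k)) ∧
          ∀ M : ℕ, 1 ≤ M → M ≤ K → ∀ P : CoopBandit.CentralizedPolicy (Fin M) K,
            P.IsConsistent ε u → ∃ σ : Equiv.Perm (Fin K),
              c * (K : ℝ) ^ (ε / (1 + ε)) * (T : ℝ) ^ (1 / (1 + ε))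
                ≤ P.groupRegret (fun k => ν (σ k)) T) := by
  refine ⟨fun ε u Δ K hε hε1 hu hΔ hΔ1 hK => ?_, 1 / 128, by norm_num,
    fun ε u K T hε _ hu hK hKT => ?_⟩
  -- Any arm can serve as the best one; arm `0` is taken.
  · obtain ⟨ν, hB, hm, hgap, h⟩ := CoopBandit.exists_instance_dependent_lower_bound hε hε1 hu hΔ hΔ1
      (⟨0, by omega⟩ : Fin K)
    refine ⟨ν, _, hB, hm, hgap, fun M G hG P hP => ?_⟩
    have : Nonempty (Fin M) := hG.nonempty
    exact h (Fin M) P.toCentralized hP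
  · obtain ⟨ν, hm, h⟩ := CoopBandit.exists_minimax_lower_bound hε hu hK hKT
    exact ⟨ν, hm, fun M hM hMK P _ => h M hM hMK P⟩
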